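/- An $s$-sparse matrix inversion instance consists of $N\ge 1$, a real number $\kappa$ and a Hermitian invertible matrix $A\in\mathbb{C}^{N\times N}$ with at most $s$ nonzero elements in each row, $\|A\|\le 1$ and $\|A^{-1}\|\le\kappa$ (spectral norm). Let $x=A^{-1}b$, where $b$ is the first standard basis vector. A relativizing classical matrix inversion algorithm for $s$-sparse matrices is a classical probabilistic algorithm that is given $N$ and $\kappa$, and has access to $A$ only through an oracle that, queried with a row index, returns the nonzero elements of this row together with their columns (one query per time step at most); on every instance it must halt with an index $i\in\{1,\dots,N\}$ whose law is within total variation distance $1/100$ of the law $i\mapsto |x_i|^2/\sum_j|x_j|^2$ of the outcome of measuring the normalized solution in the computational basis. Its running time is the maximal number of steps. Theorem. There is a constant $s_0$ such that for every $s\ge s_0$ and all real $\alpha,\beta$ the following hold. 1. If some relativizing classical matrix inversion algorithm for $s$-sparse matrices has running time at most $C\,N^{\alpha}2^{\beta\kappa}$ on all instances, for some constant $C$, then $3\alpha+4\beta\ge \frac12$. 2. If some such algorithm that is only required to work on positive definite $A$ (that is, $\kappa^{-1}I\le A\le I$) has running time at most $C\,N^{\alpha}2^{\beta\sqrt{\kappa}}$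 on all such instances, for some constant $C$, then $3\alpha+4\beta\ge\frac12$. -/

import Mathlib

open scoped Matrix.Norms.L2Operator ComplexOrder

noncomputable section

namespace MatrixInversion

/-- The nonzero elements of row `i` of `A`, each given with its column: the oracle's answer. -/
def rowEntries {N : ℕ} (A : Matrix (Fin N) (Fin N) ℂ) (i : Fin N) : Finset (Fin N × ℂ) :=
  open Classical in
  (Finset.univ.filter fun j => A i j ≠ 0).image fun j => (j, A i j)

/-- What a machine with state set `State` can do in one step: move to another state, ask the
oracle for the nonzero elements of a row and move to a state that depends on the answer, or
halt with an outcome. -/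
inductive Action (N : ℕ) (State : Type)
  | compute (next : State)
  | query (i : Fin N) (next : Finset (Fin N × ℂ) → State)
  | output (i : Fin N)

/-- A classical probabilistic machine with oracle access to an `N × N` matrix. The matrix is
accessible through oracle queries only. The action taken in a step is random, with a distribution
that depends on the current state (deterministic steps and coin tosses are special cases). No
limit is put on the state set or on the work done within one step, except that a step makes at
most one query: so Turing machines, random access machines and the like, which need at
least as many steps, are all covered. -/
structure OracleMachine (N : ℕ) where
  State : Type
  init : State
  step : State → PMF (Action N State)

namespace OracleMachine

variable {N : ℕ} (M : OracleMachine N) (A : Matrix (Fin N) (Fin N) ℂ)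

/-- The configuration after an action, when the oracle holds `A`: `Sum.inl q` means running in
state `q`, `Sum.inr i` means halted with outcome `i`. -/
def act : Action N M.State → M.State ⊕ Fin N
  | .compute q => Sum.inl q
  | .query i next => Sum.inl (next (rowEntries A i))
  | .output i => Sum.inr i

/-- One step of the computation; a halted machine stays as it is. -/
def next : M.State ⊕ Fin N → PMF (M.State ⊕ Fin N)
  | Sum.inl q => (M.step q).map (M.act A)
  | Sum.inr i => PMF.pure (Sum.inr i)

/-- The distribution of the configuration after `t` steps. -/
def run : ℕ → PMF (M.State ⊕ Fin N)
  | 0 => PMF.pure (Sum.inl M.init)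
  | t + 1 => (run t).bind (M.next A)

/-- With oracle `A`, every computation path halts within `t` steps. -/
def HaltsWithin (t : ℕ) : Prop :=
  ∀ q : M.State, M.run A t (Sum.inl q) = 0

/-- The probability that the machine has halted with outcome `i` after `t` steps. -/
def outputProb (t : ℕ) (i : Fin N) : ℝ :=
  (M.run A t (Sum.inr i)).toReal

end OracleMachine

/-- Every row has at most `s` nonzero elements. -/
def IsSparse {N : ℕ} (s : ℕ) (A : Matrix (Fin N) (Fin N) ℂ) : Prop :=
  ∀ i, (rowEntries A i).card ≤ s

/-- The matrices of the problem: `s`-sparse, Hermitian and invertible, with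
`‖A‖ ≤ 1` and `‖A⁻¹‖ ≤ κ` in the spectral norm. -/
structure IsInstance {N : ℕ} (s : ℕ) (κ : ℝ) (A : Matrix (Fin N) (Fin N) ℂ) : Prop where
  sparse : IsSparse s A
  hermitian : A.IsHermitian
  invertible : IsUnit A
  norm_le : ‖A‖ ≤ 1
  norm_inv_le : ‖A⁻¹‖ ≤ κ

/-- The solution `x = A⁻¹ b` for `b` the first basis vector. -/
def solution {N : ℕ} [NeZero N] (A : Matrix (Fin N) (Fin N) ℂ) : Fin N → ℂ :=
  A⁻¹.mulVec (Pi.single 0 1)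

/-- The probability of outcome `i` when the normalized solution is measured in the computational
basis. -/
def solutionProb {N : ℕ} [NeZero N] (A : Matrix (Fin N) (Fin N) ℂ) (i : Fin N) : ℝ :=
  ‖solution A i‖ ^ 2 / ∑ j, ‖solution A j‖ ^ 2

/-- The machine always halts within `t` steps, and the law of its outcome is within total variation
distance `ε` of the law of the measured solution. -/
def SamplesSolution {N : ℕ} [NeZero N] (M : OracleMachine N) (ε : ℝ) (t : ℕ)
    (A : Matrix (Fin N) (Fin N) ℂ) : Prop :=
  M.HaltsWithin A t ∧ (1 / 2) * ∑ i, |M.outputProb A t i - solutionProb A i| ≤ ε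

/-- A relativizing classical algorithm for `s`-sparse matrix inversion, given the dimension and
`κ` as input (as a family of machines, which need not even be uniform), that
samples from the solution with accuracy `ε` in time at most `time N κ`. -/
def SolvesInTime (alg : (N : ℕ) → ℝ → OracleMachine N) (s : ℕ) (ε : ℝ)
    (time : ℕ → ℝ → ℝ) : Prop :=
  ∀ (N : ℕ) [NeZero N] (κ : ℝ) (A : Matrix (Fin N) (Fin N) ℂ), IsInstance s κ A →
    ∃ t : ℕ, (t : ℝ) ≤ time N κ ∧ SamplesSolution (alg N κ) ε t A

/-- The same, but the algorithm has to work on positive definite matrices only. -/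
def SolvesPosDefInTime (alg : (N : ℕ) → ℝ → OracleMachine N) (s : ℕ) (ε : ℝ)
    (time : ℕ → ℝ → ℝ) : Prop :=
  ∀ (N : ℕ) [NeZero N] (κ : ℝ) (A : Matrix (Fin N) (Fin N) ℂ), IsInstance s κ A → A.PosDef →
    ∃ t : ℕ, (t : ℝ) ≤ time N κ ∧ SamplesSolution (alg N κ) ε t A

end MatrixInversion

end

/-!
The lower bound comes from Fourier sampling. Let `f` be a uniformly random assignment of signs to
`D = 16 ^ m` points. A circuit of `2 m + 1` gates, each acting on one symbol of an alphabet of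
size `16` or multiplying by `f`, prepares the Fourier transform of `f`: its amplitude at `z`
has square `W z / D`, where `W z = (∑ u, ± f u)² / D` (`norm_sq_circuitState_of_ge`).

The states of a circuit, listed along a clock of length `n`, are the solution of the linear system
`L x = b` with `L = 1 - S`, where `S` applies a gate and advances the clock. Since `S` is a nilpotent
contraction, `‖L‖ ≤ 2` and `‖L⁻¹‖ ≤ n`. Keeping the circuit idle for three quarters of the clock,
`n = 4 (2 m + 1)`, makes an outcome of the Fourier sampling likely. To get Hermitian matrices
take `[[0, L], [Lᴴ, 0]] / 2`, with condition number `2 n`, or the positive definite `LᴴL / 4`, with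
condition number `(2 n)²`; the latter has the same solution up to a factor, because `Lᴴ b = b`. A row
of either matrix involves at most `33` entries and a single sign of `f`.

A classical machine that made `t` queries knows at most `t` signs, the others being still uniformly
random, so whatever its output `z` is, the expectation of `W z` is at most `1 + t² / D`
(`OracleMachine.sum_outputProb_mul_correlation_le`). Under the true law, which is biased towards
large `W`, the expectation of `W z` truncated at `15 / 4` is almost `2` on the idle part of the
clock, by the fourth and sixth moments of a sum of random signs (`le_sum_correlation_mul_min`). As
`3 / 4 * 2` exceeds `1` by more than the sampling accuracy allows, `t ≥ √D / 2`
(`card_le_of_samplesSolution`).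

With dimension `16 ^ m` and condition number `16 m` to leading order, against `4 ^ m` steps, this
gives `α + 4 β ≥ 1 / 2` (`exponent_ge`). The identity matrices show that `α ≥ 0` (`alpha_nonneg`), and
the theorem follows.
-/

/-! ### Random signs -/

namespace MatrixInversion

/-- The sign encoded by a bit: `true` is `1` and `false` is `-1`. -/
def sgn (b : Bool) : ℝ := if b then 1 else -1

lemma sgn_sq (b : Bool) : sgn b ^ 2 = 1 := by cases b <;> norm_num [sgn]

lemma sgn_not (b : Bool) : sgn (!b) = -sgn b := by cases b <;> norm_num [sgn]

section Moments

variable {X : Type*} [Fintype X] [DecidableEq X]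

lemma sum_flip (a : X) (F : (X → Bool) → ℝ) :
    ∑ f, F (Function.update f a (!f a)) = ∑ f, F f := by
  have h : Function.Involutive fun f : X → Bool => Function.update f a (!f a) := by
    intro f; simp
  exact Equiv.sum_comp h.toPerm F

lemma abs_sign_mul {e : ℝ} (he : e ^ 2 = 1) (b : Bool) : |e * sgn b| = 1 := by
  rw [← sq_eq_sq₀ (abs_nonneg _) zero_le_one, sq_abs, mul_pow, he, sgn_sq]; norm_num

/-- Adding an independent random sign `c a * sgn (f a)` to a partial sum that does not involve `f a`
averages over a step up and a step down. -/
lemma sum_sign_step (a : X) (T : Finset X) (ha : a ∉ T) (c : X → ℝ) (hc : ∀ u, c u ^ 2 = 1)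
    (C : ℝ) (G : ℝ → ℝ) :
    ∑ f : X → Bool, G (C + ∑ u ∈ insert a T, c u * sgn (f u)) =
      ∑ f : X → Bool, (G ((C + ∑ u ∈ T, c u * sgn (f u)) + 1) +
        G ((C + ∑ u ∈ T, c u * sgn (f u)) - 1)) / 2 := by
  have hflip := sum_flip a fun f : X → Bool => G (C + ∑ u ∈ insert a T, c u * sgn (f u))
  have hT (f : X → Bool) : ∑ u ∈ T, c u * sgn (Function.update f a (!f a) u) =
      ∑ u ∈ T, c u * sgn (f u) := by
    refine Finset.sum_congr rfl fun u hu => ?_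
    rw [Function.update_of_ne (by rintro rfl; exact ha hu)]
  rw [← add_self_div_two (∑ f : X → Bool, G (C + ∑ u ∈ insert a T, c u * sgn (f u)))]
  nth_rewrite 1 [← hflip]
  rw [← Finset.sum_add_distrib, Finset.sum_div]
  refine Finset.sum_congr rfl fun f _ => ?_
  have he : (c a * sgn (f a)) ^ 2 = 1 := by rw [mul_pow, hc, sgn_sq, one_mul]
  simp only [Finset.sum_insert ha, Function.update_self, hT, sgn_not]
  rw [add_left_comm, add_left_comm C, add_comm (c a * _), add_comm (c a * _), mul_neg]
  rcases sq_eq_one_iff.1 he with h | h <;> rw [h]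
  · rw [← sub_eq_add_neg, add_comm (G _)]
  · rw [neg_neg, ← sub_eq_add_neg]

lemma sum_sign_pow_two (T : Finset X) (c : X → ℝ) (hc : ∀ u, c u ^ 2 = 1) (C : ℝ) :
    ∑ f : X → Bool, (C + ∑ u ∈ T, c u * sgn (f u)) ^ 2 =
      Fintype.card (X → Bool) * (C ^ 2 + T.card) := by
  induction T using Finset.induction_on with
  | empty => simp
  | insert a T ha ih =>
    rw [sum_sign_step a T ha c hc C (· ^ 2), Finset.card_insert_of_notMem ha]
    have h (r : ℝ) : ((r + 1) ^ 2 + (r - 1) ^ 2) / 2 = r ^ 2 + 1 := by ring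
    simp only [h, Finset.sum_add_distrib, ih]
    simp only [Finset.sum_const, Finset.card_univ, nsmul_eq_mul]
    push_cast
    ring

lemma sum_sign_pow_four (T : Finset X) (c : X → ℝ) (hc : ∀ u, c u ^ 2 = 1) :
    ∑ f : X → Bool, (∑ u ∈ T, c u * sgn (f u)) ^ 4 =
      Fintype.card (X → Bool) * (3 * (T.card : ℝ) ^ 2 - 2 * T.card) := by
  induction T using Finset.induction_on with
  | empty => simp
  | insert a T ha ih =>
    have h0 := sum_sign_step a T ha c hc 0 (· ^ 4)
    have h2 := sum_sign_pow_two T c hc 0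
    simp only [zero_add] at h0 h2
    rw [h0, Finset.card_insert_of_notMem ha]
    have h (r : ℝ) : ((r + 1) ^ 4 + (r - 1) ^ 4) / 2 = r ^ 4 + 6 * r ^ 2 + 1 := by ring
    simp only [h, Finset.sum_add_distrib, ih, ← Finset.mul_sum, h2]
    simp only [Finset.sum_const, Finset.card_univ, nsmul_eq_mul]
    push_cast
    ring

lemma sum_sign_pow_six (T : Finset X) (c : X → ℝ) (hc : ∀ u, c u ^ 2 = 1) :
    ∑ f : X → Bool, (∑ u ∈ T, c u * sgn (f u)) ^ 6 =
      Fintype.card (X → Bool) *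
        (15 * (T.card : ℝ) ^ 3 - 30 * (T.card : ℝ) ^ 2 + 16 * T.card) := by
  induction T using Finset.induction_on with
  | empty => simp
  | insert a T ha ih =>
    have h0 := sum_sign_step a T ha c hc 0 (· ^ 6)
    have h2 := sum_sign_pow_two T c hc 0
    have h4 := sum_sign_pow_four T c hc
    simp only [zero_add] at h0 h2
    rw [h0, Finset.card_insert_of_notMem ha]
    have h (r : ℝ) : ((r + 1) ^ 6 + (r - 1) ^ 6) / 2 = r ^ 6 + 15 * r ^ 4 + 15 * r ^ 2 + 1 := by
      ring
    simp only [h, Finset.sum_add_distrib, ih, ← Finset.mul_sum, h2, h4]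
    simp only [Finset.sum_const, Finset.card_univ, nsmul_eq_mul]
    push_cast
    ring

/-- The function that agrees with `σ` on `S` and with `f` elsewhere. For uniformly random `f` this is
a uniformly random function conditioned on its values on `S`. -/
def mix (S : Finset X) (σ f : X → Bool) : X → Bool := fun u => if u ∈ S then σ u else f u

omit [Fintype X] in
lemma mix_mix (S R : Finset X) (σ τ f : X → Bool) :
    mix S σ (mix R τ f) = mix (S ∪ R) (mix S σ τ) f := by
  funext u
  by_cases h1 : u ∈ S <;> by_cases h2 : u ∈ R <;> simp [mix, h1, h2]

/-- Resampling a random function outside `R` leaves its law unchanged. -/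
lemma sum_sum_mix {M : Type*} [AddCommMonoid M] (R : Finset X) (F : (X → Bool) → M) :
    ∑ τ, ∑ f, F (mix R τ f) = Fintype.card (X → Bool) • ∑ f, F f := by
  have h : Function.Involutive
      fun p : (X → Bool) × (X → Bool) => (mix R p.1 p.2, mix R p.2 p.1) := by
    intro p
    refine Prod.ext (funext fun u => ?_) (funext fun u => ?_) <;>
      by_cases h : u ∈ R <;> simp [mix, h]
  have h1 := Equiv.sum_comp h.toPerm fun p : (X → Bool) × (X → Bool) => F p.1
  rw [Fintype.sum_prod_type, Fintype.sum_prod_type] at h1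
  refine h1.trans ?_
  simp only [Finset.sum_const, Finset.card_univ, Finset.smul_sum]

/-- The squared correlation `(∑ u, c u * f u)² / |X|` of the random signs `f` with the signs `c`. -/
noncomputable def correlation (c : X → ℝ) (f : X → Bool) : ℝ := (∑ u, c u * sgn (f u)) ^ 2 / Fintype.card X

omit [DecidableEq X] in
lemma correlation_nonneg (c : X → ℝ) (f : X → Bool) : 0 ≤ correlation c f := by
  unfold correlation; positivity

/-- Knowing the values of `f` on `S` raises the expected correlation by at most `|S|² / |X|`. -/
lemma sum_correlation_mix_le [Nonempty X] (c : X → ℝ) (hc : ∀ u, c u ^ 2 = 1) (S : Finset X)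
    (σ : X → Bool) :
    ∑ f, correlation c (mix S σ f) ≤
      Fintype.card (X → Bool) * (1 + (S.card : ℝ) ^ 2 / Fintype.card X) := by
  have hX : (0 : ℝ) < Fintype.card X := by exact_mod_cast Fintype.card_pos
  have hsplit (f : X → Bool) : ∑ u, c u * sgn (mix S σ f u) =
      ∑ u ∈ S, c u * sgn (σ u) + ∑ u ∈ Sᶜ, c u * sgn (f u) := by
    rw [← Finset.sum_add_sum_compl S]
    congr 1
    · exact Finset.sum_congr rfl fun u hu => by simp [mix, hu]
    · refine Finset.sum_congr rfl fun u hu => ?_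
      rw [Finset.mem_compl] at hu
      simp [mix, hu]
  have hS : (∑ u ∈ S, c u * sgn (σ u)) ^ 2 ≤ (S.card : ℝ) ^ 2 := by
    rw [sq_le_sq, abs_of_nonneg (Nat.cast_nonneg (α := ℝ) S.card)]
    refine (Finset.abs_sum_le_sum_abs _ _).trans (le_of_eq ?_)
    rw [Finset.sum_congr rfl fun u _ => abs_sign_mul (hc u) (σ u)]
    simp
  have hcard : ((Sᶜ : Finset X).card : ℝ) ≤ Fintype.card X := by
    exact_mod_cast Finset.card_le_univ _
  simp only [correlation, hsplit]
  rw [← Finset.sum_div, sum_sign_pow_two _ c hc, mul_div_assoc]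
  refine mul_le_mul_of_nonneg_left ?_ (Nat.cast_nonneg _)
  rw [add_div, add_comm]
  gcongr
  exact (div_le_one hX).2 hcard

end Moments

end MatrixInversion

/-! ### The classical query lower bound -/

namespace MatrixInversion

lemma tsum_map_mul {α β : Type} (p : PMF α) (h : α → β) (V : β → ENNReal) :
    ∑' b, (p.map h) b * V b = ∑' a, p a * V (h a) := by
  classical
  simp only [PMF.map_apply, ← ENNReal.tsum_mul_right]
  rw [ENNReal.tsum_comm]
  refine tsum_congr fun a => ?_
  rw [tsum_eq_single (h a) fun b hb => by simp [hb]]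
  simp

namespace OracleMachine

variable {N : ℕ} (M : OracleMachine N) (A : Matrix (Fin N) (Fin N) ℂ)

/-- The expected reward after `t` more steps from a given configuration, where halting with outcome
`i` is rewarded by `g i` and not halting gives no reward. -/
noncomputable def reward (g : Fin N → ENNReal) : ℕ → M.State ⊕ Fin N → ENNReal
  | 0, c => Sum.elim (fun _ => 0) g c
  | t + 1, c => ∑' c', M.next A c c' * reward g t c'

lemma reward_inr (g : Fin N → ENNReal) (t : ℕ) (i : Fin N) :
    M.reward A g t (Sum.inr i) = g i := by
  classical
  induction t with
  | zero => rfl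
  | succ t ih =>
    rw [reward, tsum_eq_single (Sum.inr i) fun c hc => by simp [next, hc]]
    simp [next, ih]

lemma reward_inl (g : Fin N → ENNReal) (t : ℕ) (q : M.State) :
    M.reward A g (t + 1) (Sum.inl q) = ∑' a, M.step q a * M.reward A g t (M.act A a) := by
  rw [reward, next, tsum_map_mul]

lemma tsum_run_mul_reward (g : Fin N → ENNReal) (t : ℕ) :
    ∀ j, ∑' c, M.run A t c * M.reward A g j c = M.reward A g (j + t) (Sum.inl M.init) := by
  classical
  induction t with
  | zero =>
    intro j
    rw [tsum_eq_single (Sum.inl M.init) fun c hc => by simp [run, hc]]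
    simp [run]
  | succ t ih =>
    intro j
    rw [← add_assoc, add_right_comm, ← ih (j + 1)]
    simp only [run, PMF.bind_apply, ← ENNReal.tsum_mul_right]
    rw [ENNReal.tsum_comm]
    refine tsum_congr fun d => ?_
    rw [reward, ← ENNReal.tsum_mul_left]
    exact tsum_congr fun c => mul_assoc _ _ _

lemma sum_run_mul (g : Fin N → ENNReal) (t : ℕ) :
    ∑ i, M.run A t (Sum.inr i) * g i = M.reward A g t (Sum.inl M.init) := by
  rw [← zero_add t, ← tsum_run_mul_reward, zero_add, ENNReal.summable.tsum_sum ENNReal.summable]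
  simp [reward, tsum_fintype]

lemma run_inr_mono (i : Fin N) : Monotone fun t => M.run A t (Sum.inr i) := by
  classical
  refine monotone_nat_of_le_succ fun t => ?_
  simp only [run, PMF.bind_apply]
  refine le_trans (le_of_eq ?_) (ENNReal.le_tsum (Sum.inr i))
  simp [next]

lemma outputProb_mono (i : Fin N) : Monotone fun t => M.outputProb A t i := fun _ _ h =>
  ENNReal.toReal_mono (PMF.apply_ne_top _ _) (M.run_inr_mono A i h)

lemma not_haltsWithin_zero : ¬ M.HaltsWithin A 0 := fun h => by
  classical
  simpa [run] using h M.init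

/-- Suppose that each row of the hidden matrix reveals a single value of a random function `f`. If
conditioning on `k` values of `f` cannot raise the sum of the rewards above `B k`, then `t` steps
of an adaptive randomized machine cannot raise it above `B t`. -/
lemma sum_reward_mix_le {X : Type} [Fintype X] [DecidableEq X]
    (A : (X → Bool) → Matrix (Fin N) (Fin N) ℂ) (pos : Fin N → X)
    (hA : ∀ f f' i, f (pos i) = f' (pos i) → rowEntries (A f) i = rowEntries (A f') i)
    (g : (X → Bool) → Fin N → ENNReal) (B : ℕ → ENNReal) (hB : Monotone B)
    (hg : ∀ S σ i, ∑ f, g (mix S σ f) i ≤ B S.card) (t : ℕ) :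
    ∀ (S : Finset X) (σ : X → Bool) (c : M.State ⊕ Fin N),
      ∑ f, M.reward (A (mix S σ f)) (g (mix S σ f)) t c ≤ B (S.card + t) := by
  induction t with
  | zero =>
    rintro S σ (q | i)
    · simp [reward]
    · simpa [reward] using hg S σ i
  | succ t ih =>
    rintro S σ (q | i)
    · simp only [reward_inl]
      rw [← Summable.tsum_finsetSum fun _ _ => ENNReal.summable]
      simp only [← Finset.mul_sum]
      suffices h : ∀ a, ∑ f, M.reward (A (mix S σ f)) (g (mix S σ f)) t (M.act (A (mix S σ f)) a) ≤
          B (S.card + (t + 1)) by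
        refine (ENNReal.tsum_le_tsum fun a => mul_le_mul_right (h a) _).trans (le_of_eq ?_)
        rw [ENNReal.tsum_mul_right, PMF.tsum_coe, one_mul]
      rintro (q' | ⟨i, nx⟩ | i)
      · exact (ih S σ (Sum.inl q')).trans (hB (by omega))
      · -- Condition further on the value revealed by the query: the next state is then determined.
        set F : (X → Bool) → ENNReal := fun f => M.reward (A f) (g f) t (M.act (A f) (.query i nx))
          with hF
        have h1 (τ : X → Bool) : ∑ f, F (mix S σ (mix {pos i} τ f)) ≤ B (S.card + (t + 1)) := by
          have h2 (f : X → Bool) :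
              rowEntries (A (mix (S ∪ {pos i}) (mix S σ τ) f)) i = rowEntries (A (mix S σ τ)) i :=
            hA _ _ _ (by simp [mix])
          simp only [hF, mix_mix, act, h2]
          refine (ih _ _ _).trans (hB ?_)
          have := Finset.card_union_le S {pos i}
          rw [Finset.card_singleton] at this
          omega
        have h3 := sum_sum_mix {pos i} fun f => F (mix S σ f)
        have h4 := Finset.sum_le_sum fun τ (_ : τ ∈ Finset.univ) => h1 τ
        rw [h3, Finset.sum_const, Finset.card_univ, nsmul_eq_mul, nsmul_eq_mul] at h4
        exact (ENNReal.mul_le_mul_iff_right (by simp) (ENNReal.natCast_ne_top _)).1 h4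
      · exact (ih S σ (Sum.inr i)).trans (hB (by omega))
    · simpa only [reward_inr] using (hg S σ i).trans (hB (by omega))

/-- A machine that sees the random signs `f` only through the rows of `A f`, one sign per row, cannot
find outcomes `i` for which the signs `c i` are much better correlated with `f` than fixed signs. -/
theorem sum_outputProb_mul_correlation_le {X : Type} [Fintype X] [DecidableEq X] [Nonempty X]
    (A : (X → Bool) → Matrix (Fin N) (Fin N) ℂ) (pos : Fin N → X)
    (hA : ∀ f f' i, f (pos i) = f' (pos i) → rowEntries (A f) i = rowEntries (A f') i)
    (c : Fin N → X → ℝ) (hc : ∀ i u, c i u ^ 2 = 1) (t : ℕ) :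
    ∑ f, ∑ i, M.outputProb (A f) t i * correlation (c i) f ≤
      Fintype.card (X → Bool) * (1 + (t : ℝ) ^ 2 / Fintype.card X) := by
  have hpos (k : ℕ) : 0 ≤ (Fintype.card (X → Bool) : ℝ) * (1 + (k : ℝ) ^ 2 / Fintype.card X) := by
    positivity
  have key := M.sum_reward_mix_le A pos hA
    (fun f i => ENNReal.ofReal (correlation (c i) f))
    (fun k => ENNReal.ofReal (Fintype.card (X → Bool) * (1 + (k : ℝ) ^ 2 / Fintype.card X)))
    (fun a b hab => ENNReal.ofReal_le_ofReal (by gcongr))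
    (fun S σ i => by
      rw [← ENNReal.ofReal_sum_of_nonneg fun _ _ => correlation_nonneg _ _]
      exact ENNReal.ofReal_le_ofReal (sum_correlation_mix_le _ (hc i) S σ))
    t ∅ (fun _ => true) (Sum.inl M.init)
  have hmix (f : X → Bool) : mix ∅ (fun _ => true) f = f := by funext u; simp [mix]
  simp only [hmix, Finset.card_empty, zero_add, ← sum_run_mul] at key
  have hterm (f : X → Bool) (i : Fin N) :
      M.run (A f) t (Sum.inr i) * ENNReal.ofReal (correlation (c i) f) =
        ENNReal.ofReal (M.outputProb (A f) t i * correlation (c i) f) := by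
    rw [outputProb, ENNReal.ofReal_mul ENNReal.toReal_nonneg,
      ENNReal.ofReal_toReal (PMF.apply_ne_top _ _)]
  have hnn (f : X → Bool) (i : Fin N) : 0 ≤ M.outputProb (A f) t i * correlation (c i) f :=
    mul_nonneg ENNReal.toReal_nonneg (correlation_nonneg _ _)
  simp only [hterm] at key
  rw [Finset.sum_congr rfl fun f _ => (ENNReal.ofReal_sum_of_nonneg fun i _ => hnn f i).symm,
    ← ENNReal.ofReal_sum_of_nonneg fun f _ => Finset.sum_nonneg fun i _ => hnn f i] at key
  exact (ENNReal.ofReal_le_ofReal_iff (hpos t)).1 key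

end OracleMachine

end MatrixInversion

namespace MatrixInversion

/-- Under the law of random signs reweighted by their correlation with `c`, the correlation truncated
at `15 / 4` has expectation at least `2 - 2 / |X|`. -/
lemma le_sum_correlation_mul_min {X : Type} [Fintype X] [DecidableEq X] [Nonempty X] (c : X → ℝ)
    (hc : ∀ u, c u ^ 2 = 1) :
    Fintype.card (X → Bool) * (2 - 2 / (Fintype.card X : ℝ)) ≤
      ∑ f, correlation c f * min (correlation c f) (15 / 4) := by
  have hX : (0 : ℝ) < Fintype.card X := by exact_mod_cast Fintype.card_pos
  have hX1 : (1 : ℝ) ≤ Fintype.card X := by exact_mod_cast Fintype.card_pos (α := X)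
  have h4 := sum_sign_pow_four Finset.univ c hc
  have h6 := sum_sign_pow_six Finset.univ c hc
  rw [Finset.card_univ] at h4 h6
  -- A truncation is bounded below by a polynomial: `min w l ≥ w - w² / (4 l)`.
  have hmin (w : ℝ) (hw : 0 ≤ w) : w ^ 2 - w ^ 3 / 15 ≤ w * min w (15 / 4) := by
    have : w - w ^ 2 / 15 ≤ min w (15 / 4) :=
      le_min (by nlinarith [sq_nonneg w]) (by nlinarith [sq_nonneg (w - 15 / 2)])
    calc w ^ 2 - w ^ 3 / 15 = w * (w - w ^ 2 / 15) := by ring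
      _ ≤ _ := mul_le_mul_of_nonneg_left this hw
  refine le_trans ?_ (Finset.sum_le_sum fun f _ => hmin _ (correlation_nonneg c f))
  have h2 (f : X → Bool) : correlation c f ^ 2 - correlation c f ^ 3 / 15 =
      (∑ u, c u * sgn (f u)) ^ 4 / (Fintype.card X : ℝ) ^ 2 -
        (∑ u, c u * sgn (f u)) ^ 6 / (15 * (Fintype.card X : ℝ) ^ 3) := by
    unfold correlation; field_simp
  simp only [h2]
  rw [Finset.sum_sub_distrib, ← Finset.sum_div, ← Finset.sum_div, h4, h6, mul_div_assoc,
    mul_div_assoc, ← mul_sub]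
  refine mul_le_mul_of_nonneg_left ?_ (Nat.cast_nonneg _)
  generalize (Fintype.card X : ℝ) = D at *
  have : (3 * D ^ 2 - 2 * D) / D ^ 2 - (15 * D ^ 3 - 30 * D ^ 2 + 16 * D) / (15 * D ^ 3) -
      (2 - 2 / D) = (30 * D - 16) / (15 * D ^ 2) := by
    field_simp; ring
  have h3 : 0 ≤ (30 * D - 16) / (15 * D ^ 2) := div_nonneg (by linarith) (by positivity)
  linarith

/-- If each row of `A f` reveals one of the random signs `f`, and if for a family of outcomes with
total weight `3 / 4` the probability of an outcome `i` is proportional to the correlation of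
`f` with `c i`, then sampling from the solution takes at least `√|X| / 2` steps. -/
theorem card_le_of_samplesSolution {N : ℕ} [NeZero N] (M : OracleMachine N) {X : Type} [Fintype X]
    [DecidableEq X] (hX : 16 ≤ Fintype.card X) (A : (X → Bool) → Matrix (Fin N) (Fin N) ℂ)
    (pos : Fin N → X)
    (hA : ∀ f f' i, f (pos i) = f' (pos i) → rowEntries (A f) i = rowEntries (A f') i)
    (c : Fin N → X → ℝ) (hc : ∀ i u, c i u ^ 2 = 1) (I : Finset (Fin N)) (w : ℝ) (hw0 : 0 ≤ w)
    (hw : I.card * w = 3 / 4)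
    (hI : ∀ f, ∀ i ∈ I, solutionProb (A f) i = w * correlation (c i) f) (t : ℕ)
    (ht : ∀ f, ∃ t' ≤ t, SamplesSolution M (1 / 100) t' (A f)) :
    (Fintype.card X : ℝ) ≤ 4 * (t : ℝ) ^ 2 := by
  have : Nonempty X := Fintype.card_pos_iff.1 (by omega)
  have hX' : (16 : ℝ) ≤ Fintype.card X := by exact_mod_cast hX
  have hn : (0 : ℝ) < Fintype.card (X → Bool) := by exact_mod_cast Fintype.card_pos
  have upper := M.sum_outputProb_mul_correlation_le A pos hA c hc t
  have hf (f : X → Bool) : ∑ i ∈ I, w * (correlation (c i) f * min (correlation (c i) f) (15 / 4)) -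
      15 / 4 * (1 / 50) ≤ ∑ i, M.outputProb (A f) t i * correlation (c i) f := by
    obtain ⟨t', ht', -, hs⟩ := ht f
    have hi (i : Fin N) : (if i ∈ I then
          w * (correlation (c i) f * min (correlation (c i) f) (15 / 4)) else 0) -
        15 / 4 * |M.outputProb (A f) t' i - solutionProb (A f) i| ≤
        M.outputProb (A f) t i * correlation (c i) f := by
      have h0 := correlation_nonneg (c i) f
      have hp : 0 ≤ M.outputProb (A f) t' i := ENNReal.toReal_nonneg
      have hm : M.outputProb (A f) t' i ≤ M.outputProb (A f) t i :=
        M.outputProb_mono (A f) i ht'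
      have habs := abs_nonneg (M.outputProb (A f) t' i - solutionProb (A f) i)
      have hle := neg_abs_le (M.outputProb (A f) t' i - solutionProb (A f) i)
      split_ifs with hiI
      · have hm1 := min_le_left (correlation (c i) f) (15 / 4)
        have hm2 := min_le_right (correlation (c i) f) (15 / 4)
        have hm0 : 0 ≤ min (correlation (c i) f) (15 / 4) := le_min h0 (by norm_num)
        rw [← mul_assoc, ← hI f i hiI]
        calc solutionProb (A f) i * min (correlation (c i) f) (15 / 4) -
              15 / 4 * |M.outputProb (A f) t' i - solutionProb (A f) i|
            ≤ M.outputProb (A f) t' i * min (correlation (c i) f) (15 / 4) := by nlinarith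
          _ ≤ _ := mul_le_mul hm hm1 hm0 (hp.trans hm)
      · have := mul_nonneg (hp.trans hm) h0
        linarith
    refine le_trans ?_ (Finset.sum_le_sum fun i _ => hi i)
    rw [Finset.sum_sub_distrib, ← Finset.mul_sum Finset.univ _ (15 / 4 : ℝ), Finset.sum_ite_mem,
      Finset.univ_inter]
    linarith
  have lower := (Finset.sum_le_sum fun f _ => hf f).trans upper
  rw [Finset.sum_sub_distrib, Finset.sum_comm, Finset.sum_const, Finset.card_univ,
    nsmul_eq_mul] at lower
  have hmain : (3 / 4 : ℝ) * (Fintype.card (X → Bool) * (2 - 2 / (Fintype.card X : ℝ))) ≤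
      ∑ i ∈ I, ∑ f, w * (correlation (c i) f * min (correlation (c i) f) (15 / 4)) := by
    rw [← hw, mul_assoc, ← nsmul_eq_mul]
    refine Finset.card_nsmul_le_sum _ _ _ fun i _ => ?_
    rw [← Finset.mul_sum]
    exact mul_le_mul_of_nonneg_left (le_sum_correlation_mul_min _ (hc i)) hw0
  have h2 : 2 / (Fintype.card X : ℝ) ≤ 1 / 8 := by
    rw [div_le_iff₀ (by linarith)]; linarith
  have h3 : (Fintype.card (X → Bool) : ℝ) * (5 / 4) ≤
      Fintype.card (X → Bool) * (1 + (t : ℝ) ^ 2 / Fintype.card X) := by nlinarith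
  have h4 := le_of_mul_le_mul_left h3 hn
  have h5 : 1 / 4 ≤ (t : ℝ) ^ 2 / Fintype.card X := by linarith
  rw [le_div_iff₀ (by linarith)] at h5
  linarith

end MatrixInversion

/-! ### Tensor products of matrices and the circuit -/

namespace MatrixInversion

open Matrix

/-- The tensor product of the matrices `M i`. -/
def tensor {ι κ : Type} [Fintype ι] (M : ι → Matrix κ κ ℂ) : Matrix (ι → κ) (ι → κ) ℂ :=
  of fun y x => ∏ i, M i (y i) (x i)

section Tensor

variable {ι κ : Type} [Fintype ι]

lemma tensor_mul [Fintype κ] [DecidableEq ι] (M M' : ι → Matrix κ κ ℂ) :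
    tensor M * tensor M' = tensor fun i => M i * M' i := by
  ext y x
  simp only [tensor, mul_apply, of_apply, ← Finset.prod_mul_distrib]
  rw [Finset.prod_univ_sum, Fintype.piFinset_univ]

lemma tensor_one [DecidableEq ι] [DecidableEq κ] :
    tensor (fun _ : ι => (1 : Matrix κ κ ℂ)) = 1 := by
  ext y x
  simp only [tensor, of_apply, one_apply, Fintype.prod_ite_zero, Finset.prod_const_one,
    funext_iff]

lemma conjTranspose_tensor (M : ι → Matrix κ κ ℂ) : (tensor M)ᴴ = tensor fun i => (M i)ᴴ := by
  ext y x
  simp [tensor]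

end Tensor

/-- The signs of a Hadamard matrix of order `16`, the tensor square of one of order `4`. -/
def hadamardSign (a b : Fin 4 × Fin 4) : ℝ :=
  (if a.1 = b.1 then -1 else 1) * (if a.2 = b.2 then -1 else 1)

lemma hadamardSign_sq (a b : Fin 4 × Fin 4) : hadamardSign a b ^ 2 = 1 := by
  unfold hadamardSign; split_ifs <;> norm_num

/-- The symmetric orthogonal matrix of order `16` with entries `± 1 / 4`. -/
noncomputable def hadamard : Matrix (Fin 4 × Fin 4) (Fin 4 × Fin 4) ℂ :=
  of fun a b => (hadamardSign a b / 4 : ℝ)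

lemma conjTranspose_hadamard : hadamardᴴ = hadamard := by
  ext a b
  simp [hadamard, hadamardSign, eq_comm]

lemma hadamard_mul_self : hadamard * hadamard = 1 := by
  have h : hadamard = kroneckerMap (· * ·)
      (of fun a b : Fin 4 => if a = b then (-1 / 2 : ℂ) else 1 / 2)
      (of fun a b : Fin 4 => if a = b then (-1 / 2 : ℂ) else 1 / 2) := by
    ext a b
    simp only [hadamard, hadamardSign, of_apply, kroneckerMap_apply]
    split_ifs <;> norm_num
  have h4 : (of fun a b : Fin 4 => if a = b then (-1 / 2 : ℂ) else 1 / 2) *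
      (of fun a b : Fin 4 => if a = b then (-1 / 2 : ℂ) else 1 / 2) = 1 := by
    ext a b
    fin_cases a <;> fin_cases b <;> simp [mul_apply, Fin.sum_univ_four] <;> norm_num
  rw [h, ← mul_kronecker_mul, h4, one_kronecker_one]

/-- The computational basis of the circuit: strings of `m` symbols over an alphabet of size `16`. -/
abbrev Pts (m : ℕ) : Type := Fin m → Fin 4 × Fin 4

lemma card_pts (m : ℕ) : Fintype.card (Pts m) = 16 ^ m := by simp [Pts]

/-- The Hadamard matrix applied to the coordinates in `s` of a string. -/
noncomputable def hadamardOn {m : ℕ} (s : Finset (Fin m)) : Matrix (Pts m) (Pts m) ℂ :=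
  tensor fun i => if i ∈ s then hadamard else 1

lemma hadamardOn_mul {m : ℕ} {s s' : Finset (Fin m)} (h : Disjoint s s') :
    hadamardOn s * hadamardOn s' = hadamardOn (s ∪ s') := by
  rw [hadamardOn, hadamardOn, tensor_mul, hadamardOn]
  congr 1
  funext i
  by_cases h1 : i ∈ s
  · have h2 : i ∉ s' := Finset.disjoint_left.1 h h1
    simp [h1, h2]
  · by_cases h2 : i ∈ s' <;> simp [h1, h2]

lemma hadamardOn_empty {m : ℕ} : hadamardOn (∅ : Finset (Fin m)) = 1 := by
  simp [hadamardOn, tensor_one]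

lemma conjTranspose_hadamardOn {m : ℕ} (s : Finset (Fin m)) :
    (hadamardOn s)ᴴ = hadamardOn s := by
  rw [hadamardOn, conjTranspose_tensor]
  congr 1
  funext i
  split_ifs
  · exact conjTranspose_hadamard
  · exact conjTranspose_one

lemma hadamardOn_mul_self {m : ℕ} (s : Finset (Fin m)) : hadamardOn s * hadamardOn s = 1 := by
  rw [hadamardOn, tensor_mul, ← tensor_one]
  congr 1
  funext i
  split_ifs
  · exact hadamard_mul_self
  · exact one_mul 1

lemma eq_of_hadamardOn_ne_zero {m : ℕ} {s : Finset (Fin m)} {y x : Pts m}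
    (h : hadamardOn s y x ≠ 0) {i : Fin m} (hi : i ∉ s) : y i = x i := by
  simp only [hadamardOn, tensor, of_apply] at h
  have := Finset.prod_ne_zero_iff.1 h i (Finset.mem_univ i)
  simpa [hi, one_apply] using this

lemma hadamardOn_univ_apply {m : ℕ} (y x : Pts m) :
    hadamardOn Finset.univ y x = ((∏ i, hadamardSign (y i) (x i)) / 4 ^ m : ℝ) := by
  simp [hadamardOn, tensor, hadamard, Finset.prod_div_distrib]

/-- The diagonal unitary with the signs `f`. -/
noncomputable def phase {m : ℕ} (f : Pts m → Bool) : Matrix (Pts m) (Pts m) ℂ :=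
  diagonal fun x => (sgn (f x) : ℂ)

/-- The gates of the Fourier sampling circuit: Hadamard matrices on all coordinates, one at a time,
then the signs `f`, then Hadamard matrices again, and from then on nothing. -/
noncomputable def gate {m : ℕ} (f : Pts m → Bool) (t : ℕ) : Matrix (Pts m) (Pts m) ℂ :=
  if t < m then hadamardOn {i | i.val = t}
  else if t = m then phase f
  else hadamardOn {i | i.val + (m + 1) = t}

section Gate

variable {m : ℕ} (f : Pts m → Bool) (t : ℕ)

lemma conjTranspose_gate : (gate f t)ᴴ = gate f t := by
  unfold gate
  split_ifs
  · exact conjTranspose_hadamardOn _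
  · rw [phase, diagonal_conjTranspose]
    congr 1
    funext x
    simp
  · exact conjTranspose_hadamardOn _

lemma gate_mul_self : gate f t * gate f t = 1 := by
  unfold gate
  split_ifs
  · exact hadamardOn_mul_self _
  · rw [phase, diagonal_mul_diagonal, ← diagonal_one]
    congr 1
    funext x
    rw [← Complex.ofReal_mul, ← sq, sgn_sq, Complex.ofReal_one]
  · exact hadamardOn_mul_self _

/-- A gate acts on one coordinate at most. -/
lemma exists_coord_gate [NeZero m] (t : ℕ) : ∃ j : Fin m, ∀ (f : Pts m → Bool) (y x : Pts m),
    gate f t y x ≠ 0 → ∀ i ≠ j, y i = x i := by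
  have hm : 0 < m := NeZero.pos m
  unfold gate
  split_ifs with h1 h2
  · refine ⟨⟨t, h1⟩, fun _ y x h i hi => eq_of_hadamardOn_ne_zero h ?_⟩
    simpa [Fin.ext_iff] using hi
  · refine ⟨⟨0, hm⟩, fun f y x h i _ => ?_⟩
    have : y = x := by
      by_contra hne
      exact h (diagonal_apply_ne _ hne)
    rw [this]
  · refine ⟨⟨(t - (m + 1)) % m, Nat.mod_lt _ hm⟩, fun _ y x h i hi =>
      eq_of_hadamardOn_ne_zero h ?_⟩
    simp only [Finset.mem_filter, Finset.mem_univ, true_and]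
    rintro rfl
    apply hi
    simp [Nat.mod_eq_of_lt i.2]

variable {f} {f' : Pts m → Bool} {y x : Pts m}

lemma gate_congr_row (h : f y = f' y) : gate f t y x = gate f' t y x := by
  unfold gate
  split_ifs
  · rfl
  · simp only [phase, diagonal_apply, h]
  · rfl

lemma gate_congr_col (h : f x = f' x) : gate f t y x = gate f' t y x := by
  unfold gate
  split_ifs
  · rfl
  · simp only [phase, diagonal_apply]
    split_ifs with hyx
    · rw [hyx, h]
    · rfl
  · rfl

end Gate

/-- The state of the circuit, started in the basis state `0`, before gate number `t`. -/
noncomputable def circuitState {m : ℕ} (f : Pts m → Bool) : ℕ → Pts m → ℂ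
  | 0 => Pi.single 0 1
  | t + 1 => gate f t *ᵥ circuitState f t

section State

variable {m : ℕ} (f : Pts m → Bool)

lemma sum_norm_sq_circuitState (t : ℕ) : ∑ x, ‖circuitState f t x‖ ^ 2 = 1 := by
  have h (v : Pts m → ℂ) : ((∑ x, ‖v x‖ ^ 2 : ℝ) : ℂ) = star v ⬝ᵥ v := by
    simp [dotProduct, Complex.conj_mul']
  rw [← Complex.ofReal_inj, h]
  induction t with
  | zero => simp [circuitState]
  | succ t ih =>
    rw [circuitState, star_mulVec, dotProduct_mulVec, vecMul_vecMul, conjTranspose_gate,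
      gate_mul_self, vecMul_one, ih]

lemma circuitState_of_le (t : ℕ) (ht : t ≤ m) :
    circuitState f t = hadamardOn {i | i.val < t} *ᵥ Pi.single 0 1 := by
  induction t with
  | zero =>
    simp only [circuitState, Nat.not_lt_zero, Finset.filter_false, hadamardOn_empty, one_mulVec]
  | succ t ih =>
    rw [circuitState, ih (by omega), gate, if_pos (by omega), mulVec_mulVec, hadamardOn_mul]
    · congr 2
      ext i
      simp only [Finset.mem_union, Finset.mem_filter, Finset.mem_univ, true_and]
      omega
    · rw [Finset.disjoint_left]
      simp only [Finset.mem_filter, Finset.mem_univ, true_and]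
      omega

lemma circuitState_of_gt (j : ℕ) :
    circuitState f (m + 1 + j) = hadamardOn {i | i.val < j} *ᵥ
      (phase f *ᵥ (hadamardOn Finset.univ *ᵥ Pi.single 0 1)) := by
  induction j with
  | zero =>
    rw [add_zero, circuitState, circuitState_of_le f m le_rfl, gate, if_neg (by omega), if_pos rfl]
    simp [hadamardOn_empty]
  | succ j ih =>
    rw [← add_assoc, circuitState, ih, gate, if_neg (by omega), if_neg (by omega), mulVec_mulVec,
      hadamardOn_mul]
    · congr 2
      ext i
      simp only [Finset.mem_union, Finset.mem_filter, Finset.mem_univ, true_and]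
      omega
    · rw [Finset.disjoint_left]
      simp only [Finset.mem_filter, Finset.mem_univ, true_and]
      omega

/-- The signs of the Fourier transform, combined with those of the first row. -/
def fourierSign (z u : Pts m) : ℝ :=
  (∏ i, hadamardSign (z i) (u i)) * ∏ i, hadamardSign (u i) 0

lemma fourierSign_sq (z u : Pts m) : fourierSign z u ^ 2 = 1 := by
  simp [fourierSign, mul_pow, ← Finset.prod_pow, hadamardSign_sq]

/-- The circuit ends in the Fourier transform of the signs `f`. -/
lemma norm_sq_circuitState_of_ge (t : ℕ) (ht : 2 * m + 1 ≤ t) (z : Pts m) :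
    ‖circuitState f t z‖ ^ 2 = (1 / 16 ^ m) * correlation (fourierSign z) f := by
  obtain ⟨j, rfl⟩ := Nat.exists_eq_add_of_le (show m + 1 ≤ t by omega)
  have hj : (Finset.univ.filter fun i : Fin m => i.val < j) = Finset.univ :=
    Finset.filter_true_of_mem fun i _ => by omega
  have h : circuitState f (m + 1 + j) z =
      ((∑ u, fourierSign z u * sgn (f u)) / 16 ^ m : ℝ) := by
    rw [circuitState_of_gt, hj, mulVec_single_one]
    simp only [mulVec, dotProduct, phase, hadamardOn_univ_apply, diagonal_apply, ite_mul, zero_mul,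
      Finset.sum_ite_eq, Finset.mem_univ, if_true, col_apply]
    rw [Finset.sum_div]
    push_cast
    refine Finset.sum_congr rfl fun u _ => ?_
    have h16 : (16 : ℂ) ^ m = 4 ^ m * 4 ^ m := by rw [← mul_pow]; norm_num
    rw [h16, fourierSign]
    push_cast
    simp only [Pi.zero_apply]
    field_simp
  rw [h, Complex.norm_real, Real.norm_eq_abs, sq_abs, correlation, card_pts]
  push_cast
  field_simp

end State

end MatrixInversion

/-! ### The clock construction -/

namespace MatrixInversion

open Matrix

lemma l2_opNorm_one_le {J : Type*} [Fintype J] [DecidableEq J] : ‖(1 : Matrix J J ℂ)‖ ≤ 1 := by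
  rw [← diagonal_one, l2_opNorm_diagonal]
  exact (pi_norm_le_iff_of_nonneg zero_le_one).2 fun _ => by simp

/-- The clock shift with unitaries: it maps `|t⟩|x⟩` to `|t + 1⟩ (G t) |x⟩`, and to `0` when `t` is
the last time. -/
def shift {X : Type} (n : ℕ) (G : ℕ → Matrix X X ℂ) : Matrix (Fin n × X) (Fin n × X) ℂ :=
  of fun p q => if p.1.val = q.1.val + 1 then G q.1 p.2 q.2 else 0

section Shift

variable {X : Type} [Fintype X] [DecidableEq X] {n : ℕ} {G : ℕ → Matrix X X ℂ}

lemma conjTranspose_shift_mul_self (hG : ∀ t, (G t)ᴴ * G t = 1) :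
    (shift n G)ᴴ * shift n G = diagonal fun q => if q.1.val + 1 < n then 1 else 0 := by
  ext p q
  simp only [mul_apply, conjTranspose_apply, shift, of_apply, Fintype.sum_prod_type,
    diagonal_apply]
  by_cases hpq : p.1 = q.1
  · by_cases hn : q.1.val + 1 < n
    · rw [Finset.sum_eq_single (⟨q.1.val + 1, hn⟩ : Fin n)]
      · have h := congrFun (congrFun (hG q.1) p.2) q.2
        simp only [mul_apply, conjTranspose_apply, one_apply] at h
        simp only [hpq, if_true, h, hn, Prod.ext_iff, true_and]
      · intro t _ ht
        have : ¬ t.val = q.1.val + 1 := fun h => ht (Fin.ext h)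
        simp [this]
      · simp
    · have (t : Fin n) : ¬ t.val = q.1.val + 1 := by omega
      simp only [this, if_false, mul_zero, Finset.sum_const_zero, hpq, hn, ite_self]
  · have hne : p ≠ q := fun h => hpq (by rw [h])
    have (t : Fin n) : ¬ (t.val = p.1.val + 1 ∧ t.val = q.1.val + 1) := by
      rintro ⟨h1, h2⟩
      exact hpq (Fin.ext (by omega))
    rw [if_neg hne]
    refine Finset.sum_eq_zero fun t _ => Finset.sum_eq_zero fun x _ => ?_
    by_cases h1 : t.val = p.1.val + 1
    · rw [if_neg fun h2 => this t ⟨h1, h2⟩, mul_zero]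
    · rw [if_neg h1, star_zero, zero_mul]

lemma norm_shift_le (hG : ∀ t, (G t)ᴴ * G t = 1) : ‖shift n G‖ ≤ 1 := by
  have h : ‖shift n G‖ * ‖shift n G‖ ≤ 1 := by
    rw [← l2_opNorm_conjTranspose_mul_self, conjTranspose_shift_mul_self hG, l2_opNorm_diagonal]
    refine (pi_norm_le_iff_of_nonneg zero_le_one).2 fun q => ?_
    split_ifs <;> simp
  nlinarith [norm_nonneg (shift n G)]

lemma shift_pow_apply (j : ℕ) (p q : Fin n × X) (h : (shift n G ^ j) p q ≠ 0) :
    p.1.val = q.1.val + j := by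
  induction j generalizing p with
  | zero =>
    rw [pow_zero, one_apply] at h
    rw [show p = q by by_contra hne; exact h (if_neg hne), add_zero]
  | succ j ih =>
    rw [pow_succ', mul_apply] at h
    obtain ⟨r, -, hr⟩ := Finset.exists_ne_zero_of_sum_ne_zero h
    have h1 := ih r (right_ne_zero_of_mul hr)
    have h2 : p.1.val = r.1.val + 1 := by
      by_contra hne
      exact left_ne_zero_of_mul hr (if_neg hne)
    omega

lemma shift_pow_eq_zero : shift n G ^ n = 0 := by
  ext p q
  by_contra h
  have := shift_pow_apply n p q h
  omega

/-- The inverse of `1 - shift n G`. -/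
noncomputable def shiftSum (n : ℕ) (G : ℕ → Matrix X X ℂ) : Matrix (Fin n × X) (Fin n × X) ℂ :=
  ∑ j ∈ Finset.range n, shift n G ^ j

lemma one_sub_shift_mul : (1 - shift n G) * shiftSum n G = 1 := by
  rw [shiftSum, mul_neg_geom_sum, shift_pow_eq_zero, sub_zero]

lemma norm_shiftSum_le (hG : ∀ t, (G t)ᴴ * G t = 1) : ‖shiftSum n G‖ ≤ n := by
  refine (norm_sum_le _ _).trans ?_
  refine (Finset.sum_le_sum (g := fun _ => (1 : ℝ)) fun j _ => ?_).trans (by simp)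
  rcases j.eq_zero_or_pos with rfl | hj
  · rw [pow_zero]
    exact l2_opNorm_one_le
  · exact (norm_pow_le' _ hj).trans (pow_le_one₀ (norm_nonneg _) (norm_shift_le hG))

lemma norm_one_sub_shift_le (hG : ∀ t, (G t)ᴴ * G t = 1) : ‖1 - shift n G‖ ≤ 2 := by
  refine (norm_sub_le _ _).trans ?_
  linarith [norm_shift_le (n := n) hG, l2_opNorm_one_le (J := Fin n × X)]

/-- The history of a computation solves the linear system of its clock. -/
lemma one_sub_shift_mulVec [NeZero n] (ψ : ℕ → X → ℂ) (hψ : ∀ t, ψ (t + 1) = G t *ᵥ ψ t) :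
    ((1 - shift n G) *ᵥ fun p => ψ p.1 p.2) = fun p => if p.1 = 0 then ψ 0 p.2 else 0 := by
  funext p
  rw [sub_mulVec, one_mulVec, Pi.sub_apply]
  simp only [mulVec, dotProduct, shift, of_apply, Fintype.sum_prod_type]
  split_ifs with hp
  · simp [hp]
  · have hp' : p.1.val ≠ 0 := fun h => hp (Fin.ext (by simpa using h))
    rw [Finset.sum_eq_single (⟨p.1.val - 1, by omega⟩ : Fin n)]
    · have h1 : p.1.val = p.1.val - 1 + 1 := by omega
      have h2 : ψ p.1 p.2 = ∑ x, G (p.1.val - 1) p.2 x * ψ (p.1.val - 1) x := by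
        conv_lhs => rw [h1, hψ]
        rfl
      simp only [← h1, if_true]
      rw [h2, sub_self]
    · intro t _ ht
      have : ¬ p.1.val = t.val + 1 := fun h => ht (Fin.ext (by simp [h]))
      simp [this]
    · simp

end Shift

end MatrixInversion

/-! ### From matrices over finite types to instances -/

namespace MatrixInversion

open Matrix

lemma l2_opNorm_le_iff {J J' : Type*} [Fintype J] [DecidableEq J] [Fintype J'] [DecidableEq J']
    (A : Matrix J J' ℂ) {c : ℝ} (hc : 0 ≤ c) :
    ‖A‖ ≤ c ↔ ∀ v : J' → ℂ, ∑ i, ‖(A *ᵥ v) i‖ ^ 2 ≤ c ^ 2 * ∑ i, ‖v i‖ ^ 2 := by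
  rw [l2_opNorm_def, ContinuousLinearMap.opNorm_le_iff hc]
  have h (v : J' → ℂ) : ‖(toEuclideanLin (𝕜 := ℂ) A).toContinuousLinearMap (WithLp.toLp 2 v)‖ ≤
      c * ‖WithLp.toLp 2 v‖ ↔ ∑ i, ‖(A *ᵥ v) i‖ ^ 2 ≤ c ^ 2 * ∑ i, ‖v i‖ ^ 2 := by
    rw [← sq_le_sq₀ (norm_nonneg _) (by positivity), mul_pow, EuclideanSpace.norm_sq_eq,
      EuclideanSpace.norm_sq_eq]
    rfl
  exact ⟨fun H v => (h v).1 (H _), fun H v => (h v.ofLp).2 (H _)⟩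

section Submatrix

variable {N : ℕ} {J : Type} [Fintype J] [DecidableEq J] (e : Fin N ≃ J)

lemma norm_submatrix_le (A : Matrix J J ℂ) : ‖A.submatrix e e‖ ≤ ‖A‖ := by
  rw [l2_opNorm_le_iff _ (norm_nonneg A)]
  intro v
  have h := (l2_opNorm_le_iff A (norm_nonneg A)).1 le_rfl (v ∘ e.symm)
  rw [submatrix_mulVec_equiv]
  simp only [Function.comp_apply]
  rw [e.sum_comp fun j => ‖(A *ᵥ (v ∘ e.symm)) j‖ ^ 2]
  refine h.trans (le_of_eq ?_)
  rw [← e.symm.sum_comp fun i => ‖v i‖ ^ 2]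
  rfl

lemma isInstance_submatrix {s : ℕ} {κ : ℝ} {A B : Matrix J J ℂ}
    (hs : ∀ p, ∃ F : Finset J, F.card ≤ s ∧ ∀ q, A p q ≠ 0 → q ∈ F)
    (hA : A.IsHermitian) (hAB : A * B = 1) (hA1 : ‖A‖ ≤ 1) (hB : ‖B‖ ≤ κ) :
    IsInstance s κ (A.submatrix e e) where
  sparse i := by
    classical
    obtain ⟨F, hF, hq⟩ := hs (e i)
    unfold rowEntries
    refine Finset.card_image_le.trans (le_trans ?_ hF)
    refine Finset.card_le_card_of_injOn e (fun j hj => ?_) e.injective.injOn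
    simp only [Finset.coe_filter, Finset.mem_univ, true_and, Set.mem_ofPred_eq] at hj
    exact hq _ hj
  hermitian := hA.submatrix e
  invertible := by
    refine IsUnit.of_mul_eq_one (B.submatrix e e) ?_
    rw [submatrix_mul_equiv, hAB, submatrix_one_equiv]
  norm_le := (norm_submatrix_le e A).trans hA1
  norm_inv_le := by
    rw [inv_submatrix_equiv, inv_eq_right_inv hAB]
    exact (norm_submatrix_le e B).trans hB

lemma solutionProb_submatrix [NeZero N] {A B : Matrix J J ℂ} (hAB : A * B = 1) {x : J → ℂ}
    (hx : A *ᵥ x = Pi.single (e 0) 1) (i : Fin N) :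
    solutionProb (A.submatrix e e) i = ‖x (e i)‖ ^ 2 / ∑ j, ‖x j‖ ^ 2 := by
  have h : solution (A.submatrix e e) = x ∘ e := by
    have hb : (Pi.single 0 1 : Fin N → ℂ) ∘ e.symm = Pi.single (e 0) 1 := by
      funext j
      simp [Pi.single_apply, Equiv.symm_apply_eq]
    rw [solution, inv_submatrix_equiv, submatrix_mulVec_equiv, inv_eq_right_inv hAB, hb, ← hx,
      mulVec_mulVec, mul_eq_one_comm.1 hAB, one_mulVec]
  rw [solutionProb, h]
  simp only [Function.comp_apply]
  rw [e.sum_comp fun j => ‖x j‖ ^ 2]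

/-- There is an enumeration of `J` that starts with a given element. -/
lemma exists_equiv_fin [NeZero N] (hN : Fintype.card J = N) (j₀ : J) :
    ∃ e : Fin N ≃ J, e 0 = j₀ := by
  subst hN
  exact ⟨(Fintype.equivFin J).symm.trans (Equiv.swap ((Fintype.equivFin J).symm 0) j₀), by simp⟩

omit [Fintype J] [DecidableEq J] in
lemma rowEntries_submatrix_congr {A A' : Matrix J J ℂ} {i : Fin N}
    (h : ∀ q, A (e i) q = A' (e i) q) :
    rowEntries (A.submatrix e e) i = rowEntries (A'.submatrix e e) i := by
  simp only [rowEntries, submatrix_apply, h]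
  congr!

end Submatrix

/-- The number of clock times: the Fourier sampling circuit with `2 m + 1` gates fills a quarter of
them, and is idle in the remaining ones. -/
def clock (m : ℕ) : ℕ := 4 * (2 * m + 1)

instance (m : ℕ) : NeZero (clock m) := ⟨by unfold clock; omega⟩

/-- The basis of the clock register and the circuit register. -/
abbrev Config (m : ℕ) : Type := Fin (clock m) × Pts m

/-- The solution of the clock system: the superposition of all states of the circuit. -/
noncomputable def history {m : ℕ} (f : Pts m → Bool) (p : Config m) : ℂ :=
  circuitState f p.1 p.2

/-- The matrix of the clock system of the Fourier sampling circuit. -/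
noncomputable def clockMatrix {m : ℕ} (f : Pts m → Bool) : Matrix (Config m) (Config m) ℂ :=
  1 - shift (clock m) (gate f)

/-- The inverse of `clockMatrix f`. -/
noncomputable def clockInverse {m : ℕ} (f : Pts m → Bool) : Matrix (Config m) (Config m) ℂ :=
  shiftSum (clock m) (gate f)

section ClockMatrix

variable {m : ℕ} (f : Pts m → Bool)

lemma conjTranspose_gate_mul_self (t : ℕ) : (gate f t)ᴴ * gate f t = 1 := by
  rw [conjTranspose_gate, gate_mul_self]

lemma clockMatrix_mul_inverse : clockMatrix f * clockInverse f = 1 := one_sub_shift_mul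

lemma clockInverse_mul : clockInverse f * clockMatrix f = 1 :=
  mul_eq_one_comm.1 (clockMatrix_mul_inverse f)

lemma norm_clockMatrix_le : ‖clockMatrix f‖ ≤ 2 :=
  norm_one_sub_shift_le (conjTranspose_gate_mul_self f)

lemma norm_clockInverse_le : ‖clockInverse f‖ ≤ clock m :=
  norm_shiftSum_le (conjTranspose_gate_mul_self f)

lemma clockMatrix_mulVec_history : clockMatrix f *ᵥ history f = Pi.single (0, 0) 1 := by
  refine (one_sub_shift_mulVec (circuitState f) fun _ => rfl).trans ?_
  funext ⟨t, x⟩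
  simp only [circuitState, Pi.single_apply, Prod.mk.injEq]
  split_ifs <;> simp_all

lemma sum_norm_sq_history : ∑ p, ‖history f p‖ ^ 2 = clock m := by
  rw [Fintype.sum_prod_type]
  simp [history, sum_norm_sq_circuitState]

/-- The configurations in which the circuit has ended. -/
def idleConfigs (m : ℕ) : Finset (Config m) := {p | 2 * m + 1 ≤ p.1.val}

lemma card_idleConfigs : (idleConfigs m).card = 3 * (2 * m + 1) * 16 ^ m := by
  have h : idleConfigs m = (Finset.univ.filter fun t : Fin (clock m) => 2 * m + 1 ≤ t.val) ×ˢ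
      (Finset.univ : Finset (Pts m)) := by
    ext p
    simp [idleConfigs]
  have h2 : (Finset.univ.filter fun t : Fin (clock m) => ¬ 2 * m + 1 ≤ t.val).card =
      2 * m + 1 := by
    simp only [not_le]
    rw [Fin.card_filter_val_lt]
    unfold clock
    omega
  have h3 := Finset.card_filter_add_card_filter_not (s := Finset.univ)
    fun t : Fin (clock m) => 2 * m + 1 ≤ t.val
  rw [Finset.card_univ, Fintype.card_fin] at h3
  rw [h, Finset.card_product, Finset.card_univ, card_pts]
  congr 1
  unfold clock at *
  omega

lemma norm_sq_history {p : Config m} (hp : p ∈ idleConfigs m) :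
    ‖history f p‖ ^ 2 = 1 / 16 ^ m * correlation (fourierSign p.2) f :=
  norm_sq_circuitState_of_ge f _ (by simpa [idleConfigs] using hp) _

variable {f} {f' : Pts m → Bool} {p q : Config m}

lemma clockMatrix_congr_row (h : f p.2 = f' p.2) : clockMatrix f p q = clockMatrix f' p q := by
  simp only [clockMatrix, Matrix.sub_apply, shift, of_apply, gate_congr_row _ h]

lemma clockMatrix_congr_col (h : f q.2 = f' q.2) : clockMatrix f p q = clockMatrix f' p q := by
  simp only [clockMatrix, Matrix.sub_apply, shift, of_apply, gate_congr_col _ h]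

variable (f p)

lemma shift_row_sparse [NeZero m] : ∃ F : Finset (Config m), F.card ≤ 16 ∧
    ∀ q, shift (clock m) (gate f) p q ≠ 0 → q ∈ F := by
  obtain ⟨j, hj⟩ := exists_coord_gate (m := m) (p.1.val - 1)
  refine ⟨Finset.univ.image fun a : Fin 4 × Fin 4 =>
    (Fin.ofNat (clock m) (p.1.val - 1), Function.update p.2 j a), ?_, fun q hq => ?_⟩
  · exact Finset.card_image_le.trans (by simp)
  · simp only [shift, of_apply, ne_eq, ite_eq_right_iff, Classical.not_imp] at hq
    obtain ⟨h1, h2⟩ := hq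
    have h3 : q.1.val = p.1.val - 1 := by omega
    rw [h3] at h2
    refine Finset.mem_image.2 ⟨q.2 j, Finset.mem_univ _, Prod.ext (Fin.ext ?_) ?_⟩
    · simp [← h3]
    · exact Function.update_eq_iff.2 ⟨rfl, fun i hi => hj f _ _ h2 i hi⟩

lemma shift_col_sparse [NeZero m] : ∃ F : Finset (Config m), F.card ≤ 16 ∧
    ∀ q, shift (clock m) (gate f) q p ≠ 0 → q ∈ F := by
  obtain ⟨j, hj⟩ := exists_coord_gate (m := m) p.1.val
  refine ⟨Finset.univ.image fun a : Fin 4 × Fin 4 =>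
    (Fin.ofNat (clock m) (p.1.val + 1), Function.update p.2 j a), ?_, fun q hq => ?_⟩
  · exact Finset.card_image_le.trans (by simp)
  · simp only [shift, of_apply, ne_eq, ite_eq_right_iff, Classical.not_imp] at hq
    obtain ⟨h1, h2⟩ := hq
    refine Finset.mem_image.2 ⟨q.2 j, Finset.mem_univ _, Prod.ext (Fin.ext ?_) ?_⟩
    · simp [← h1]
    · exact Function.update_eq_iff.2 ⟨rfl, fun i hi => (hj f _ _ h2 i hi).symm⟩

/-- Row `p` and column `p` of the clock matrix have their nonzero entries in a set of size `33`. -/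
lemma clockMatrix_sparse [NeZero m] : ∃ F : Finset (Config m), F.card ≤ 33 ∧
    ∀ q, q = p ∨ shift (clock m) (gate f) p q ≠ 0 ∨ shift (clock m) (gate f) q p ≠ 0 → q ∈ F := by
  obtain ⟨F, hF, hF'⟩ := shift_row_sparse f p
  obtain ⟨G, hG, hG'⟩ := shift_col_sparse f p
  refine ⟨insert p (F ∪ G), ?_, ?_⟩
  · have h1 := Finset.card_insert_le p (F ∪ G)
    have h2 := Finset.card_union_le F G
    omega
  · rintro q (h | h | h)
    · simp [h]
    · simp [hF' q h]
    · simp [hG' q h]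

end ClockMatrix

/-- The lower bound for a family of matrices `A f`, whose rows reveal one sign each, and whose
solutions consist of copies of the history state: with weight `3 / 4`, the outcome is that of an
idle configuration. -/
theorem steps_of_family {m : ℕ} [NeZero m] {N : ℕ} [NeZero N] {J : Type} [Fintype J] [DecidableEq J]
    (e : Fin N ≃ J) (A B : (Pts m → Bool) → Matrix J J ℂ) (hAB : ∀ f, A f * B f = 1)
    (pos : J → Pts m) (hA : ∀ f f' p q, f (pos p) = f' (pos p) → A f p q = A f' p q)
    (x : (Pts m → Bool) → J → ℂ) (hx : ∀ f, A f *ᵥ x f = Pi.single (e 0) 1) (a : ℝ) (ha : a ≠ 0)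
    (hsum : ∀ f, ∑ p, ‖x f p‖ ^ 2 = a * clock m) (ι : Config m ↪ J) (hpos : ∀ p, pos (ι p) = p.2)
    (hι : ∀ f p, ‖x f (ι p)‖ ^ 2 = a * ‖history f p‖ ^ 2)
    (M : OracleMachine N) (t : ℕ)
    (ht : ∀ f, ∃ t' ≤ t, SamplesSolution M (1 / 100) t' ((A f).submatrix e e)) :
    (16 : ℝ) ^ m ≤ 4 * (t : ℝ) ^ 2 := by
  have hclock : (clock m : ℝ) = 4 * (2 * m + 1) := by unfold clock; push_cast; ring
  have h := card_le_of_samplesSolution M (X := Pts m) ?_ (fun f => (A f).submatrix e e)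
    (fun i => pos (e i)) (fun f f' i h => rowEntries_submatrix_congr e fun q => hA f f' _ q h)
    (fun i => fourierSign (pos (e i))) (fun i u => fourierSign_sq _ _)
    (((idleConfigs m).map ι).map e.symm.toEmbedding) (1 / (clock m * 16 ^ m)) (by positivity) ?_ ?_
    t ht
  · rw [card_pts] at h
    exact_mod_cast h
  · rw [card_pts]
    exact Nat.le_self_pow (NeZero.ne m) 16
  · rw [Finset.card_map, Finset.card_map, card_idleConfigs, hclock]
    push_cast
    field_simp
  · intro f i hi
    obtain ⟨j, hj, rfl⟩ := Finset.mem_map.1 hi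
    obtain ⟨p, hp, rfl⟩ := Finset.mem_map.1 hj
    rw [solutionProb_submatrix e (hAB f) (hx f), hsum]
    simp only [Equiv.coe_toEmbedding, Equiv.apply_symm_apply, hι, hpos, norm_sq_history f hp]
    rw [hclock]
    field_simp

end MatrixInversion

/-! ### The hard instances -/

namespace MatrixInversion

open Matrix

section Hermitian

variable {J : Type} [Fintype J] [DecidableEq J]

lemma norm_fromBlocks_conjTranspose_le (A : Matrix J J ℂ) : ‖fromBlocks 0 A Aᴴ 0‖ ≤ ‖A‖ := by
  rw [l2_opNorm_le_iff _ (norm_nonneg A)]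
  intro v
  have h1 := (l2_opNorm_le_iff A (norm_nonneg A)).1 le_rfl (v ∘ Sum.inr)
  have h2 := (l2_opNorm_le_iff Aᴴ (norm_nonneg A)).1 (l2_opNorm_conjTranspose A).le (v ∘ Sum.inl)
  rw [fromBlocks_mulVec, Fintype.sum_sum_type, Fintype.sum_sum_type]
  simp only [Sum.elim_inl, Sum.elim_inr, zero_mulVec, zero_add, add_zero, Function.comp_apply]
    at h1 h2 ⊢
  linarith

end Hermitian

/-- The indefinite instance, which solves the clock system by means of `[[0, L], [Lᴴ, 0]]`. -/
noncomputable def indefinite {m : ℕ} (f : Pts m → Bool) :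
    Matrix (Config m ⊕ Config m) (Config m ⊕ Config m) ℂ :=
  (1 / 2 : ℂ) • fromBlocks 0 (clockMatrix f) (clockMatrix f)ᴴ 0

/-- The inverse of `indefinite f`, written with `ᴴᴴ` so that it has the same shape. -/
noncomputable def indefiniteInverse {m : ℕ} (f : Pts m → Bool) :
    Matrix (Config m ⊕ Config m) (Config m ⊕ Config m) ℂ :=
  (2 : ℂ) • fromBlocks 0 (clockInverse f)ᴴ (clockInverse f)ᴴᴴ 0

/-- The positive definite instance, which solves the clock system by means of `LᴴL`. -/
noncomputable def definite {m : ℕ} (f : Pts m → Bool) : Matrix (Config m) (Config m) ℂ :=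
  (1 / 4 : ℂ) • ((clockMatrix f)ᴴ * clockMatrix f)

/-- The inverse of `definite f`. -/
noncomputable def definiteInverse {m : ℕ} (f : Pts m → Bool) : Matrix (Config m) (Config m) ℂ :=
  (4 : ℂ) • (clockInverse f * (clockInverse f)ᴴ)

section Instances

variable {m : ℕ} (f : Pts m → Bool)

lemma indefinite_mul_inverse : indefinite f * indefiniteInverse f = 1 := by
  have h : (clockMatrix f)ᴴ * (clockInverse f)ᴴ = 1 := by
    rw [← conjTranspose_mul, clockInverse_mul, conjTranspose_one]
  rw [indefinite, indefiniteInverse, smul_mul_smul_comm, fromBlocks_multiply,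
    conjTranspose_conjTranspose, clockMatrix_mul_inverse, h]
  simp [fromBlocks_one]

lemma definite_mul_inverse : definite f * definiteInverse f = 1 := by
  have h : (clockMatrix f)ᴴ * (clockInverse f)ᴴ = 1 := by
    rw [← conjTranspose_mul, clockInverse_mul, conjTranspose_one]
  rw [definite, definiteInverse, smul_mul_smul_comm, Matrix.mul_assoc,
    ← Matrix.mul_assoc (clockMatrix f), clockMatrix_mul_inverse, Matrix.one_mul, h]
  norm_num

lemma norm_indefinite_le : ‖indefinite f‖ ≤ 1 := by
  rw [indefinite, norm_smul]
  have h := (norm_fromBlocks_conjTranspose_le (clockMatrix f)).trans (norm_clockMatrix_le f)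
  norm_num
  linarith

lemma norm_indefiniteInverse_le : ‖indefiniteInverse f‖ ≤ 2 * clock m := by
  rw [indefiniteInverse, norm_smul, Complex.norm_ofNat]
  have h := (norm_fromBlocks_conjTranspose_le (clockInverse f)ᴴ).trans
    ((l2_opNorm_conjTranspose _).le.trans (norm_clockInverse_le f))
  linarith

lemma norm_definite_le : ‖definite f‖ ≤ 1 := by
  rw [definite, norm_smul, l2_opNorm_conjTranspose_mul_self]
  have h := norm_clockMatrix_le f
  have h0 := norm_nonneg (clockMatrix f)
  norm_num
  nlinarith

lemma norm_definiteInverse_le : ‖definiteInverse f‖ ≤ (2 * clock m) ^ 2 := by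
  have h2 := l2_opNorm_mul (clockInverse f) (clockInverse f)ᴴ
  rw [l2_opNorm_conjTranspose] at h2
  rw [definiteInverse, norm_smul, Complex.norm_ofNat]
  have h := norm_clockInverse_le f
  have h0 := norm_nonneg (clockInverse f)
  nlinarith

lemma isHermitian_indefinite : (indefinite f).IsHermitian := by
  rw [IsHermitian, indefinite, conjTranspose_smul, fromBlocks_conjTranspose]
  simp

lemma posDef_definite : (definite f).PosDef := by
  have hu : IsUnit ((clockMatrix f)ᴴ * clockMatrix f) := by
    have h : IsUnit (clockMatrix f) := IsUnit.of_mul_eq_one _ (clockMatrix_mul_inverse f)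
    exact h.star.mul h
  have hp := ((posSemidef_conjTranspose_mul_self (clockMatrix f)).posDef_iff_isUnit).2 hu
  refine hp.smul ?_
  norm_num [Complex.lt_def]

/-- The entries of the positive definite instance: the product `SᴴS` of the clock shift is a
projection that does not depend on the circuit. -/
lemma definite_eq : definite f = (1 / 4 : ℂ) • (1 - shift (clock m) (gate f) -
    (shift (clock m) (gate f))ᴴ + diagonal fun q => if q.1.val + 1 < clock m then 1 else 0) := by
  rw [definite, clockMatrix, conjTranspose_sub, conjTranspose_one, Matrix.sub_mul, Matrix.mul_sub,
    Matrix.mul_sub, conjTranspose_shift_mul_self (conjTranspose_gate_mul_self f), Matrix.one_mul,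
    Matrix.mul_one, Matrix.one_mul]
  congr 1
  abel

lemma definite_sparse [NeZero m] (p : Config m) :
    ∃ F : Finset (Config m), F.card ≤ 33 ∧ ∀ q, definite f p q ≠ 0 → q ∈ F := by
  obtain ⟨F, hF, h⟩ := clockMatrix_sparse f p
  refine ⟨F, hF, fun q hq => h q ?_⟩
  by_contra! h0
  obtain ⟨h1, h2, h3⟩ := h0
  apply hq
  simp [definite_eq, one_apply, h1.symm, h2, h3]

lemma indefinite_sparse [NeZero m] (p : Config m ⊕ Config m) :
    ∃ F : Finset (Config m ⊕ Config m), F.card ≤ 33 ∧ ∀ q, indefinite f p q ≠ 0 → q ∈ F := by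
  rcases p with p | p
  · obtain ⟨F, hF, h⟩ := clockMatrix_sparse f p
    refine ⟨F.map .inr, by rwa [Finset.card_map], ?_⟩
    rintro (q | q) hq
    · simp [indefinite] at hq
    · refine Finset.mem_map_of_mem _ (h q ?_)
      by_contra! h0
      obtain ⟨h1, h2, -⟩ := h0
      apply hq
      simp [indefinite, clockMatrix, one_apply, h1.symm, h2]
  · obtain ⟨F, hF, h⟩ := clockMatrix_sparse f p
    refine ⟨F.map .inl, by rwa [Finset.card_map], ?_⟩
    rintro (q | q) hq
    · refine Finset.mem_map_of_mem _ (h q ?_)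
      by_contra! h0
      obtain ⟨h1, -, h3⟩ := h0
      apply hq
      simp [indefinite, clockMatrix, one_apply, h1.symm, h3]
    · simp [indefinite] at hq

lemma indefinite_mulVec :
    indefinite f *ᵥ Sum.elim 0 ((2 : ℂ) • history f) = Pi.single (Sum.inl (0, 0)) 1 := by
  rw [indefinite, smul_mulVec, fromBlocks_mulVec]
  simp only [Sum.elim_comp_inl, Sum.elim_comp_inr, mulVec_smul, clockMatrix_mulVec_history,
    mulVec_zero, zero_mulVec, zero_add]
  funext p
  rcases p with p | p
  · simp [Pi.single_apply]
  · simp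

lemma definite_mulVec : definite f *ᵥ ((4 : ℂ) • history f) = Pi.single (0, 0) 1 := by
  rw [definite, smul_mulVec, mulVec_smul, ← mulVec_mulVec, clockMatrix_mulVec_history, smul_smul]
  norm_num
  funext p
  simp only [col_apply, conjTranspose_apply, clockMatrix, Matrix.sub_apply, shift, of_apply,
    one_apply, Pi.single_apply]
  simp [eq_comm]

variable {f} {f' : Pts m → Bool}

lemma definite_congr {p q : Config m} (h : f p.2 = f' p.2) : definite f p q = definite f' p q := by
  have h1 := clockMatrix_congr_row (q := q) h
  have h2 := clockMatrix_congr_col (p := q) h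
  simp only [clockMatrix, Matrix.sub_apply, sub_right_inj] at h1 h2
  simp only [definite_eq, Matrix.smul_apply, Matrix.add_apply, Matrix.sub_apply,
    conjTranspose_apply, h1, h2]

lemma indefinite_congr {p q : Config m ⊕ Config m}
    (h : f (Sum.elim Prod.snd Prod.snd p) = f' (Sum.elim Prod.snd Prod.snd p)) :
    indefinite f p q = indefinite f' p q := by
  rcases p with p | p <;> rcases q with q | q
  · simp [indefinite]
  · simp [indefinite, clockMatrix_congr_row (q := q) h]
  · simp [indefinite, clockMatrix_congr_col (p := q) h]
  · simp [indefinite]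

end Instances

/-- A machine that solves all indefinite instances takes exponentially many steps. -/
theorem steps_indefinite (m : ℕ) [NeZero m] (N : ℕ) [NeZero N] (hN : N = 2 * (clock m * 16 ^ m))
    {s : ℕ} (hs : 33 ≤ s) (M : OracleMachine N) (t : ℕ)
    (ht : ∀ A, IsInstance s (2 * clock m) A → ∃ t' ≤ t, SamplesSolution M (1 / 100) t' A) :
    (16 : ℝ) ^ m ≤ 4 * (t : ℝ) ^ 2 := by
  have hcard : Fintype.card (Config m ⊕ Config m) = N := by
    rw [Fintype.card_sum, Fintype.card_prod, Fintype.card_fin, card_pts, hN, two_mul]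
  obtain ⟨e, he⟩ := exists_equiv_fin hcard (Sum.inl ((0 : Fin (clock m)), (0 : Pts m)))
  refine steps_of_family e indefinite indefiniteInverse indefinite_mul_inverse
    (Sum.elim Prod.snd Prod.snd) (fun f f' p q h => indefinite_congr h)
    (fun f => Sum.elim 0 ((2 : ℂ) • history f)) (fun f => by rw [he, indefinite_mulVec])
    4 (by norm_num) (fun f => ?_) .inr (fun p => rfl) (fun f p => ?_) M t fun f => ht _ ?_
  · rw [Fintype.sum_sum_type, ← sum_norm_sq_history f, Finset.mul_sum]
    simp [mul_pow]
    norm_num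
  · simp [mul_pow]
    norm_num
  · exact isInstance_submatrix e
      (fun p => (indefinite_sparse f p).imp fun F h => ⟨h.1.trans hs, h.2⟩)
      (isHermitian_indefinite f) (indefinite_mul_inverse f) (norm_indefinite_le f)
      (norm_indefiniteInverse_le f)

/-- A machine that solves all definite instances takes exponentially many steps. -/
theorem steps_definite (m : ℕ) [NeZero m] (N : ℕ) [NeZero N] (hN : N = clock m * 16 ^ m)
    {s : ℕ} (hs : 33 ≤ s) (M : OracleMachine N) (t : ℕ)
    (ht : ∀ A, IsInstance s ((2 * clock m) ^ 2) A → A.PosDef →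
      ∃ t' ≤ t, SamplesSolution M (1 / 100) t' A) :
    (16 : ℝ) ^ m ≤ 4 * (t : ℝ) ^ 2 := by
  have hcard : Fintype.card (Config m) = N := by
    rw [Fintype.card_prod, Fintype.card_fin, card_pts, hN]
  obtain ⟨e, he⟩ := exists_equiv_fin hcard ((0 : Fin (clock m)), (0 : Pts m))
  refine steps_of_family e definite definiteInverse definite_mul_inverse
    Prod.snd (fun f f' p q h => definite_congr h)
    (fun f => (4 : ℂ) • history f) (fun f => by rw [he, definite_mulVec])
    16 (by norm_num) (fun f => ?_) (.refl _) (fun p => rfl) (fun f p => ?_) M t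
    fun f => ht _ ?_ ((posDef_definite f).submatrix e.injective)
  · rw [← sum_norm_sq_history f, Finset.mul_sum]
    simp [mul_pow]
    norm_num
  · simp [mul_pow]
    norm_num
  · exact isInstance_submatrix e
      (fun p => (definite_sparse f p).imp fun F h => ⟨h.1.trans hs, h.2⟩)
      (posDef_definite f).1 (definite_mul_inverse f) (norm_definite_le f)
      (norm_definiteInverse_le f)

end MatrixInversion

/-! ### Asymptotics of the running time -/

namespace MatrixInversion

open Filter Topology

/-- Up to lower order terms, a running time of `(16 ^ m) ^ α * 2 ^ (16 m β)` is at least `4 ^ m`. -/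
lemma exponent_ge {α β C : ℝ} {c : ℕ} (hc : 0 < c)
    (h : ∀ m : ℕ, 0 < m → (16 : ℝ) ^ m ≤ 4 * (⌊C * (((c * (clock m * 16 ^ m) : ℕ) : ℝ) ^ α *
      (2 : ℝ) ^ (β * (2 * clock m)))⌋₊ : ℝ) ^ 2) :
    1 / 2 ≤ α + 4 * β := by
  by_contra! hlt
  have hc' : (0 : ℝ) < c := by exact_mod_cast hc
  -- In the variable `y = c * clock m` the steps outgrow the running time by a factor of order
  -- `exp (b * y) / y ^ α`.
  set y : ℕ → ℝ := fun m => c * clock m with hy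
  set b : ℝ := Real.log 2 * (2 - 4 * α - 16 * β) / (8 * c) with hb
  have hlog : 0 < Real.log 2 := Real.log_pos one_lt_two
  have hb0 : 0 < b := by
    apply div_pos (mul_pos hlog (by linarith)) (by positivity)
  have hytop : Tendsto y atTop atTop := by
    refine Tendsto.const_mul_atTop hc' (tendsto_natCast_atTop_atTop.comp ?_)
    exact tendsto_atTop_mono (fun m => by simp only [id, clock]; omega) tendsto_id
  have hlim := ((tendsto_rpow_mul_exp_neg_mul_atTop_nhds_zero α b hb0).comp hytop).const_mul
    (2 * C * Real.exp (4 * c * b + 8 * β * Real.log 2))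
  rw [mul_zero] at hlim
  obtain ⟨m, hm1, hm⟩ := ((hlim.eventually_lt_const zero_lt_one).and
    (eventually_gt_atTop 0)).exists
  have hy0 : 0 < y m := mul_pos hc' (by exact_mod_cast NeZero.pos (clock m))
  have hym : y m = c * (4 * (2 * m + 1)) := by simp [hy, clock]
  have h16 : (16 : ℝ) ^ m = (4 ^ m) ^ 2 := by rw [← pow_mul, mul_comm m 2, pow_mul]; norm_num
  have hm' := h m hm
  set τ : ℝ := C * (((c * (clock m * 16 ^ m) : ℕ) : ℝ) ^ α * (2 : ℝ) ^ (β * (2 * clock m))) with hτ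
  have h4 : (4 : ℝ) ^ m ≤ 2 * ⌊τ⌋₊ := by
    rw [← sq_le_sq₀ (by positivity) (by positivity), ← h16, mul_pow]
    norm_num
    exact hm'
  -- The natural floor of a negative number is `0`, which is too few steps.
  have hτ0 : 0 ≤ τ := by
    by_contra! hneg
    rw [Nat.floor_of_nonpos hneg.le] at h4
    have : (0 : ℝ) < 4 ^ m := by positivity
    norm_num at h4
    linarith
  have h5 : (4 : ℝ) ^ m ≤ 2 * τ := h4.trans (by linarith [Nat.floor_le hτ0])
  have e4 : (4 : ℝ) ^ m = Real.exp (2 * m * Real.log 2) := by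
    rw [show (4 : ℝ) = 2 ^ 2 by norm_num, ← pow_mul, ← Real.rpow_natCast,
      Real.rpow_def_of_pos two_pos]
    push_cast
    ring_nf
  have eN : ((c * (clock m * 16 ^ m) : ℕ) : ℝ) ^ α =
      y m ^ α * Real.exp (4 * m * α * Real.log 2) := by
    push_cast
    rw [← mul_assoc, Real.mul_rpow hy0.le (by positivity)]
    congr 1
    rw [show (16 : ℝ) = 2 ^ 4 by norm_num, ← pow_mul, ← Real.rpow_natCast, ← Real.rpow_mul two_pos.le,
      Real.rpow_def_of_pos two_pos]
    push_cast
    ring_nf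
  have eκ : (2 : ℝ) ^ (β * (2 * clock m)) = Real.exp (β * (16 * m + 8) * Real.log 2) := by
    rw [Real.rpow_def_of_pos two_pos]
    unfold clock
    push_cast
    ring_nf
  rw [e4, hτ, eN, eκ] at h5
  have h6 := mul_le_mul_of_nonneg_right h5 (Real.exp_nonneg (-(2 * m * Real.log 2)))
  rw [← Real.exp_add, add_neg_cancel, Real.exp_zero] at h6
  refine absurd hm1 (not_lt.2 (h6.trans (le_of_eq ?_)))
  have hexp : Real.exp (4 * m * α * Real.log 2) * Real.exp (β * (16 * m + 8) * Real.log 2) *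
      Real.exp (-(2 * m * Real.log 2)) =
      Real.exp (4 * c * b + 8 * β * Real.log 2) * Real.exp (-b * y m) := by
    rw [← Real.exp_add, ← Real.exp_add, ← Real.exp_add, hym, hb]
    congr 1
    field_simp
    ring
  simp only [Function.comp_apply]
  linear_combination 2 * C * y m ^ α * hexp

lemma isInstance_one {N s : ℕ} (hs : 1 ≤ s) : IsInstance s 1 (1 : Matrix (Fin N) (Fin N) ℂ) := by
  have h := isInstance_submatrix (Equiv.refl (Fin N)) (s := s) (κ := 1) (A := 1) (B := 1)
    (fun p => ⟨{p}, by simpa using hs, fun q hq => ?_⟩) Matrix.isHermitian_one (one_mul 1)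
    l2_opNorm_one_le l2_opNorm_one_le
  · simpa using h
  · rw [Finset.mem_singleton]
    by_contra hne
    exact hq (Matrix.one_apply_ne (Ne.symm hne))

/-- For `α < 0` a large identity matrix would have to be handled in less than one step. -/
lemma alpha_nonneg {α D : ℝ} {alg : (N : ℕ) → ℝ → OracleMachine N} {ε : ℝ}
    (h : ∀ (N : ℕ) [NeZero N], ∃ t : ℕ, (t : ℝ) ≤ D * (N : ℝ) ^ α ∧
      SamplesSolution (alg N 1) ε t (1 : Matrix (Fin N) (Fin N) ℂ)) : 0 ≤ α := by
  by_contra! hα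
  have hlim : Tendsto (fun N : ℕ => D * (N : ℝ) ^ α) atTop (𝓝 0) := by
    have := ((tendsto_rpow_neg_atTop (neg_pos.2 hα)).comp
      tendsto_natCast_atTop_atTop).const_mul D
    simpa [Function.comp_def] using this
  obtain ⟨N, hN1, hN⟩ := ((hlim.eventually_lt_const zero_lt_one).and
    (eventually_gt_atTop 0)).exists
  have : NeZero N := ⟨hN.ne'⟩
  obtain ⟨t, ht, hs⟩ := h N
  have ht0 : t = 0 := by
    have : (t : ℝ) < 1 := ht.trans_lt hN1
    have : t < 1 := by exact_mod_cast this
    omega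
  subst ht0
  exact OracleMachine.not_haltsWithin_zero _ _ hs.1

end MatrixInversion

theorem theorem3 :
    ∃ s₀ : ℕ, ∀ s : ℕ, s₀ ≤ s → ∀ α β C : ℝ,
      ∀ alg : (N : ℕ) → ℝ → MatrixInversion.OracleMachine N,
        (MatrixInversion.SolvesInTime alg s (1 / 100)
            (fun N κ => C * ((N : ℝ) ^ α * (2 : ℝ) ^ (β * κ))) →
          1 / 2 ≤ 3 * α + 4 * β) ∧
        (MatrixInversion.SolvesPosDefInTime alg s (1 / 100)
            (fun N κ => C * ((N : ℝ) ^ α * (2 : ℝ) ^ (β * √κ))) →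
          1 / 2 ≤ 3 * α + 4 * β) := by
  open MatrixInversion in
  refine ⟨33, fun s hs α β C alg => ⟨fun h => ?_, fun h => ?_⟩⟩
  · have hα : 0 ≤ α := alpha_nonneg (D := C * 2 ^ β) (alg := alg) (ε := 1 / 100) fun N _ => by
      obtain ⟨t, ht, h1⟩ := h N 1 1 (isInstance_one (by omega))
      exact ⟨t, ht.trans (le_of_eq (by beta_reduce; rw [mul_one]; ring)), h1⟩
    have hβ : 1 / 2 ≤ α + 4 * β := exponent_ge (C := C) two_pos fun m hm => by
      have : NeZero m := ⟨hm.ne'⟩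
      have : NeZero (2 * (clock m * 16 ^ m)) := ⟨by simp [NeZero.ne]⟩
      refine steps_indefinite m _ rfl hs (alg _ (2 * clock m)) _ fun A hA => ?_
      obtain ⟨t, ht, h1⟩ := h _ _ A hA
      exact ⟨t, Nat.le_floor ht, h1⟩
    linarith
  · have hα : 0 ≤ α := alpha_nonneg (D := C * 2 ^ β) (alg := alg) (ε := 1 / 100) fun N _ => by
      obtain ⟨t, ht, h1⟩ := h N 1 1 (isInstance_one (by omega)) Matrix.PosDef.one
      exact ⟨t, ht.trans (le_of_eq (by beta_reduce; rw [Real.sqrt_one, mul_one]; ring)), h1⟩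
    have hβ : 1 / 2 ≤ α + 4 * β := exponent_ge (C := C) one_pos fun m hm => by
      have : NeZero m := ⟨hm.ne'⟩
      have : NeZero (1 * (clock m * 16 ^ m)) := ⟨by simp [NeZero.ne]⟩
      refine steps_definite m _ (one_mul _) hs (alg _ ((2 * clock m) ^ 2)) _ fun A hA hA' => ?_
      obtain ⟨t, ht, h1⟩ := h _ _ A hA hA'
      beta_reduce at ht
      rw [Real.sqrt_sq (by positivity)] at ht
      exact ⟨t, Nat.le_floor ht, h1⟩
    linarith
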